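/- Let $S$ be a real number. There is a constant $c>0$, depending only on $S$, with the following property. Let $G$ be a compact (Hausdorff) abelian group with normalized Haar measure $\mu$ and dual group $\Gamma$ (the continuous characters $G\to\mathbb T$), and for a continuous function $f:G\to\mathbb C$ and $\gamma\in\Gamma$ write $\hat f(\gamma)=\int_G f\,\overline{\gamma}\,d\mu$. Let $E\subset\Gamma$ be a Sidon set, i.e. suppose there is a constant $C>0$ such that $\sum_{\gamma\in\Gamma}|\hat f(\gamma)|\le C\|f\|_\infty$ for every continuous $f:G\to\mathbb C$ with $\hat f(\gamma)=0$ for all $\gamma\notin E$, and suppose that its Sidon constant $S(E)$, the infimum of all such $C$, equals $S$. Let $B$ be any complex Banach space, $N\ge 0$ an integer, $\gamma_1,\dots,\gamma_N$ distinct elements of $E$, $a_1,\dots,a_N\in B$, and $\alpha>0$. Then $$c^{-1}P\Big[\Big\|\sum_{n=1}^N a_nr_n\Big\|\ge c\alpha\Big]\le \mu\Big[\Big\|\sum_{n=1}^N a_n\gamma_n\Big\|\ge\alpha\Big]\le c\,P\Big[\Big\|\sum_{n=1}^N a_nr_n\Big\|\ge c^{-1}\alpha\Big],$$ where $P$ is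 Lebesgue measure on $[0,1]$ and $r_n(t)=(-1)^{\lfloor 2^n t\rfloor}$, $n\geq 1$, are the Rademacher functions on $[0,1]$. -/

import Mathlib

open MeasureTheory

noncomputable section

namespace Sidon

/-- The normalized Haar measure on a compact group. -/
def haarProb (G : Type*) [CommGroup G] [TopologicalSpace G] [IsTopologicalGroup G]
    [CompactSpace G] [MeasurableSpace G] [BorelSpace G] : Measure G :=
  Measure.haarMeasure (⊤ : TopologicalSpace.PositiveCompacts G)

section

variable {G : Type*} [CommGroup G] [TopologicalSpace G] [IsTopologicalGroup G]
    [CompactSpace G] [MeasurableSpace G] [BorelSpace G]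

/-- The Fourier coefficient of `f` at the character `γ`, that is, the integral of `f` times the
complex conjugate of `γ` against normalized Haar measure. -/
def fourierHat (f : C(G, ℂ)) (γ : PontryaginDual G) : ℂ :=
  ∫ x, f x * (starRingEnd ℂ) ((γ x : Circle) : ℂ) ∂(haarProb G)

/-- `f` is `E`-spectral: its Fourier transform is supported in `E`. -/
def IsSpectral (E : Set (PontryaginDual G)) (f : C(G, ℂ)) : Prop :=
  ∀ γ : PontryaginDual G, γ ∉ E → fourierHat f γ = 0

/-- `c > 0` is a constant of sidonicity for `E`: the sum over the dual group of the moduli of the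
Fourier coefficients of `f` is at most `c` times the sup norm of `f`, for every continuous
`E`-spectral `f`. The sum is taken in `[0, ∞]`, so its finiteness is part of the condition. -/
def IsSidonBound (E : Set (PontryaginDual G)) (c : ℝ) : Prop :=
  0 < c ∧ ∀ f : C(G, ℂ), IsSpectral E f →
    ∑' γ : PontryaginDual G, ENNReal.ofReal ‖fourierHat f γ‖ ≤ ENNReal.ofReal (c * ‖f‖)

/-- `E` is a Sidon set. -/
def IsSidonSet (E : Set (PontryaginDual G)) : Prop :=
  ∃ c : ℝ, IsSidonBound E c

/-- The Sidon constant `S(E)` of a Sidon set `E`: the smallest constant of sidonicity. -/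
def sidonConstant (E : Set (PontryaginDual G)) : ℝ :=
  sInf {c : ℝ | IsSidonBound E c}

end

/-- The `n`-th Rademacher function (`n ≥ 1`) on `[0, 1]`: alternately `1` and `-1` on the
successive dyadic intervals of length `2⁻ⁿ`. -/
def rademacher (n : ℕ) (t : ℝ) : ℝ := (-1 : ℝ) ^ ⌊(2 : ℝ) ^ n * t⌋

/-- Lebesgue measure on `[0, 1]`, the probability measure for the Rademacher functions. -/
def unitLebesgue : Measure ℝ := volume.restrict (Set.Icc (0 : ℝ) 1)

end Sidon

end

/-!
The distributions of the character sum `Y = ‖∑ γₙ aₙ‖` and of the Rademacher sum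
`X = ‖∑ rₙ aₙ‖` are compared through their moments of order `p = 2, 4, 8, …`.

*Moments are comparable.* By Hahn–Banach in `ℂᴺ`, the Sidon inequality says that every
multiplier bounded by `1` on the characters is, up to the factor `C`, a limit of convex combinations
of the multipliers `z γₙ(g)` with `|z| = 1` and `g ∈ G`
(`IsSidonBound.smul_mem_closure_convexHull`). These last act on `∑ γₙ aₙ` by translation and
rotation and keep its moments; since the `p`-th moment is a convex function of the
multiplier, every multiplier bounded by `1` costs at most `C ^ p`
(`IsSidonBound.integral_multiplier_le`). Apply this to random signs and average: for fixed `x`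
the sum `∑ εₙ γₙ(x) aₙ` is a Rademacher sum with unimodular multipliers, which cost at most `2 ^ p`
(`signMean_contraction`). So the `Lᵖ` norms of `X` and `Y` agree up to the factor `2 C`.

*Moments can be doubled.* Hypercontractivity (`hypercontractive_signSum`) gives
`‖X‖₂ₚ ≤ 2 ‖X‖ₚ` with a constant that does not depend on `p`, and the comparison transfers this
to `Y` with another constant.

*Moments determine tails.* With doubling, the Paley–Zygmund inequality gives
`P[Y ≥ ‖Y‖ₚ / 2] ≥ e^(-κ p)`, while Markov's inequality gives `P[X ≥ M ‖X‖ₚ] ≤ M ^ (-p)`. For a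
suitable `M` the second is smaller than the first, also with `p / 2` in place of `p`, and this is
the comparison of tails (`measureReal_ge_le_of_moments`), in either direction.
-/

namespace Sidon

/-! ### Averages over signs and hypercontractivity -/

/-- The average of `φ` over the `2 ^ N` choices of signs, uniformly weighted. -/
noncomputable def signMean {N : ℕ} (φ : (Fin N → ℤˣ) → ℝ) : ℝ := (∑ ε, φ ε) / 2 ^ N

theorem signMean_zero (φ : (Fin 0 → ℤˣ) → ℝ) : signMean φ = φ default := by
  simp only [signMean, Fintype.sum_unique, pow_zero, div_one]
  exact congrArg φ (Subsingleton.elim _ _)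

theorem signMean_succ {N : ℕ} (φ : (Fin (N + 1) → ℤˣ) → ℝ) :
    signMean φ = (signMean (fun ε => φ (Fin.cons 1 ε)) +
      signMean (fun ε => φ (Fin.cons (-1) ε))) / 2 := by
  have h : ∑ ε, φ ε = ∑ ε, φ (Fin.cons 1 ε) + ∑ ε, φ (Fin.cons (-1) ε) := by
    rw [← (Fin.consEquiv (fun _ : Fin (N + 1) => ℤˣ)).sum_comp, Fintype.sum_prod_type,
      UnitsInt.univ, Finset.sum_pair (by decide)]
    rfl
  simp only [signMean, h, pow_succ]
  field_simp

theorem signMean_mono {N : ℕ} {φ ψ : (Fin N → ℤˣ) → ℝ} (h : ∀ ε, φ ε ≤ ψ ε) :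
    signMean φ ≤ signMean ψ :=
  div_le_div_of_nonneg_right (Finset.sum_le_sum fun ε _ => h ε) (by positivity)

theorem signMean_nonneg {N : ℕ} {φ : (Fin N → ℤˣ) → ℝ} (h : ∀ ε, 0 ≤ φ ε) : 0 ≤ signMean φ :=
  div_nonneg (Finset.sum_nonneg fun ε _ => h ε) (by positivity)

theorem signMean_add {N : ℕ} (φ ψ : (Fin N → ℤˣ) → ℝ) :
    signMean (fun ε => φ ε + ψ ε) = signMean φ + signMean ψ := by
  simp [signMean, Finset.sum_add_distrib, add_div]

theorem signMean_const_mul {N : ℕ} (c : ℝ) (φ : (Fin N → ℤˣ) → ℝ) :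
    signMean (fun ε => c * φ ε) = c * signMean φ := by
  simp [signMean, ← Finset.mul_sum, mul_div_assoc]

theorem signMean_const {N : ℕ} (c : ℝ) : signMean (fun _ : Fin N → ℤˣ => c) = c := by
  simp [signMean]

theorem signMean_mul_left {N : ℕ} (σ : Fin N → ℤˣ) (φ : (Fin N → ℤˣ) → ℝ) :
    signMean (fun ε => φ (σ * ε)) = signMean φ := by
  simp only [signMean]
  rw [← Equiv.sum_comp (Equiv.mulLeft σ) φ]
  rfl

theorem sq_signMean_mul_le {N : ℕ} (φ ψ : (Fin N → ℤˣ) → ℝ) :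
    signMean (fun ε => φ ε * ψ ε) ^ 2 ≤
      signMean (fun ε => φ ε ^ 2) * signMean (fun ε => ψ ε ^ 2) := by
  simp only [signMean, div_pow, div_mul_div_comm, ← sq]
  exact div_le_div_of_nonneg_right (Finset.sum_mul_sq_le_sq_mul_sq _ _ _) (by positivity)

/-- Minkowski's inequality in `L²` over the signs, with the norms of the two functions replaced by
upper bounds. -/
theorem signMean_add_sq_le {N : ℕ} (φ ψ : (Fin N → ℤˣ) → ℝ) {x y : ℝ} (hx : 0 ≤ x) (hy : 0 ≤ y)
    (hφ : signMean (fun ε => φ ε ^ 2) ≤ x ^ 2) (hψ : signMean (fun ε => ψ ε ^ 2) ≤ y ^ 2) :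
    signMean (fun ε => (φ ε + ψ ε) ^ 2) ≤ (x + y) ^ 2 := by
  have hcs : signMean (fun ε => φ ε * ψ ε) ≤ x * y := by
    refine le_of_sq_le_sq ?_ (by positivity)
    rw [mul_pow]
    exact (sq_signMean_mul_le φ ψ).trans
      (mul_le_mul hφ hψ (signMean_nonneg fun _ => sq_nonneg _) (sq_nonneg x))
  have h : signMean (fun ε => (φ ε + ψ ε) ^ 2) = signMean (fun ε => φ ε ^ 2) +
      2 * signMean (fun ε => φ ε * ψ ε) + signMean (fun ε => ψ ε ^ 2) := by
    rw [← signMean_const_mul, ← signMean_add, ← signMean_add]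
    congr 1
    ext ε
    ring
  rw [h]
  nlinarith

/-- The two-point inequality for exponents that are powers of two. Squaring both numbers
`a ± d` turns the pair `(a, d)` into `(a² + d², 2ad)`, and this doubles the exponent. -/
theorem two_point_real (k : ℕ) (a d : ℝ) :
    ((a + d / 2) ^ (2 * 2 ^ (k + 1)) + (a - d / 2) ^ (2 * 2 ^ (k + 1))) / 2 ≤
      (((a + d) ^ 2 ^ (k + 1) + (a - d) ^ 2 ^ (k + 1)) / 2) ^ 2 := by
  induction k generalizing a d with
  | zero =>
    norm_num
    nlinarith [sq_nonneg (a * d), sq_nonneg (d ^ 2)]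
  | succ k ih =>
    have e : 2 * 2 ^ (k + 1 + 1) = 2 * (2 * 2 ^ (k + 1)) := by ring
    have e' : 2 ^ (k + 1 + 1) = 2 * 2 ^ (k + 1) := by ring
    have h := ih (a ^ 2 + d ^ 2) (2 * a * d)
    rw [show a ^ 2 + d ^ 2 + 2 * a * d = (a + d) ^ 2 by ring,
      show a ^ 2 + d ^ 2 - 2 * a * d = (a - d) ^ 2 by ring, ← pow_mul, ← pow_mul, ← e'] at h
    refine le_trans ?_ h
    rw [e, pow_mul (a + d / 2), pow_mul (a - d / 2)]
    have h1 : (a + d / 2) ^ 2 ≤ a ^ 2 + d ^ 2 + 2 * a * d / 2 := by nlinarith [sq_nonneg d]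
    have h2 : (a - d / 2) ^ 2 ≤ a ^ 2 + d ^ 2 - 2 * a * d / 2 := by nlinarith [sq_nonneg d]
    have h3 := pow_le_pow_left₀ (sq_nonneg _) h1 (2 * 2 ^ (k + 1))
    have h4 := pow_le_pow_left₀ (sq_nonneg _) h2 (2 * 2 ^ (k + 1))
    rw [← e'] at h3 h4 ⊢
    linarith

section Normed

variable {B : Type*} [NormedAddCommGroup B] [NormedSpace ℂ B]

/-- The vector-valued two-point inequality reduces to the real one: as `u ± v / 2` are convex
combinations of `u + v` and `u - v`, their norms are bounded by those of `‖u + v‖` and `‖u - v‖`. -/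
theorem two_point_norm (k : ℕ) (u v : B) :
    (‖u + (1 / 2 : ℂ) • v‖ ^ (2 * 2 ^ (k + 1)) + ‖u - (1 / 2 : ℂ) • v‖ ^ (2 * 2 ^ (k + 1))) / 2 ≤
      ((‖u + v‖ ^ 2 ^ (k + 1) + ‖u - v‖ ^ 2 ^ (k + 1)) / 2) ^ 2 := by
  have key : ∀ v : B, ‖u + (1 / 2 : ℂ) • v‖ ≤
      (‖u + v‖ + ‖u - v‖) / 2 + ((‖u + v‖ - ‖u - v‖) / 2) / 2 := by
    intro v
    have h : u + (1 / 2 : ℂ) • v = (3 / 4 : ℂ) • (u + v) + (1 / 4 : ℂ) • (u - v) := by module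
    rw [h]
    refine (norm_add_le _ _).trans ?_
    rw [norm_smul, norm_smul]
    norm_num
    linarith
  have h1 := key v
  have h2 := key (-v)
  rw [smul_neg, ← sub_eq_add_neg, ← sub_eq_add_neg, sub_neg_eq_add] at h2
  have h := two_point_real k ((‖u + v‖ + ‖u - v‖) / 2) ((‖u + v‖ - ‖u - v‖) / 2)
  rw [show (‖u + v‖ + ‖u - v‖) / 2 + (‖u + v‖ - ‖u - v‖) / 2 = ‖u + v‖ by ring,
    show (‖u + v‖ + ‖u - v‖) / 2 - (‖u + v‖ - ‖u - v‖) / 2 = ‖u - v‖ by ring] at h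
  refine le_trans ?_ h
  gcongr
  linarith

/-- The Rademacher sum with coefficients `a`, as a function of the signs. -/
noncomputable def signSum {N : ℕ} (a : Fin N → B) (ε : Fin N → ℤˣ) : B := ∑ n, ((ε n : ℤ) : ℂ) • a n

theorem signSum_cons_one {N : ℕ} (a : Fin (N + 1) → B) (ε : Fin N → ℤˣ) :
    signSum a (Fin.cons 1 ε) = a 0 + signSum (fun n => a n.succ) ε := by
  simp [signSum, Fin.sum_univ_succ]

theorem signSum_cons_neg_one {N : ℕ} (a : Fin (N + 1) → B) (ε : Fin N → ℤˣ) :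
    signSum a (Fin.cons (-1) ε) = -a 0 + signSum (fun n => a n.succ) ε := by
  simp [signSum, Fin.sum_univ_succ]

/-- Hypercontractivity of vector-valued Rademacher sums. The induction on the number of signs
applies the two-point inequality to one sign and Minkowski's inequality in `L²` to the others; it
needs the free vector `b`, into which the first coefficient is absorbed. -/
theorem hypercontractive_signSum (k : ℕ) {N : ℕ} (b : B) (a : Fin N → B) :
    signMean (fun ε => ‖b + (1 / 2 : ℂ) • signSum a ε‖ ^ (2 * 2 ^ (k + 1))) ≤
      signMean (fun ε => ‖b + signSum a ε‖ ^ 2 ^ (k + 1)) ^ 2 := by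
  induction N generalizing b with
  | zero =>
    simp only [signMean_zero]
    simp [signSum, ← pow_mul, mul_comm]
  | succ N ih =>
    set a' : Fin N → B := fun n => a n.succ with ha'
    set q := 2 ^ (k + 1) with hq
    have hp : ∀ x : ℝ, x ^ (2 * q) = (x ^ q) ^ 2 := fun x => by rw [← pow_mul, mul_comm]
    have hmink := signMean_add_sq_le (fun ε => ‖(b + a 0) + (1 / 2 : ℂ) • signSum a' ε‖ ^ q)
      (fun ε => ‖(b - a 0) + (1 / 2 : ℂ) • signSum a' ε‖ ^ q)
      (signMean_nonneg (φ := fun ε => ‖(b + a 0) + signSum a' ε‖ ^ q) fun ε => by positivity)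
      (signMean_nonneg (φ := fun ε => ‖(b - a 0) + signSum a' ε‖ ^ q) fun ε => by positivity)
      (by simpa only [hp] using ih (b + a 0) a') (by simpa only [hp] using ih (b - a 0) a')
    rw [signMean_succ, signMean_succ, ← signMean_add]
    simp only [signSum_cons_one, signSum_cons_neg_one, ← ha', ← add_assoc, ← sub_eq_add_neg]
    have hpt : ∀ ε, ‖b + (1 / 2 : ℂ) • (a 0 + signSum a' ε)‖ ^ (2 * q) +
        ‖b + (1 / 2 : ℂ) • (-a 0 + signSum a' ε)‖ ^ (2 * q) ≤
        (1 / 2) * (‖(b + a 0) + (1 / 2 : ℂ) • signSum a' ε‖ ^ q +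
          ‖(b - a 0) + (1 / 2 : ℂ) • signSum a' ε‖ ^ q) ^ 2 := by
      intro ε
      have h := two_point_norm k (b + (1 / 2 : ℂ) • signSum a' ε) (a 0)
      rw [← hq] at h
      rw [show b + (1 / 2 : ℂ) • (a 0 + signSum a' ε) =
          b + (1 / 2 : ℂ) • signSum a' ε + (1 / 2 : ℂ) • a 0 by module,
        show b + (1 / 2 : ℂ) • (-a 0 + signSum a' ε) =
          b + (1 / 2 : ℂ) • signSum a' ε - (1 / 2 : ℂ) • a 0 by module,
        show b + a 0 + (1 / 2 : ℂ) • signSum a' ε = b + (1 / 2 : ℂ) • signSum a' ε + a 0 by abel,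
        show b - a 0 + (1 / 2 : ℂ) • signSum a' ε = b + (1 / 2 : ℂ) • signSum a' ε - a 0 by abel]
      linarith
    have hm := signMean_mono hpt
    rw [signMean_const_mul] at hm
    linarith

/-- Doubling the exponent costs a factor `2` in the `Lᵖ` norm of a Rademacher sum, whatever the
exponent `p = 2, 4, 8, …` is. -/
theorem signMean_norm_signSum_doubling (k : ℕ) {N : ℕ} (a : Fin N → B) :
    signMean (fun ε => ‖signSum a ε‖ ^ (2 * 2 ^ (k + 1))) ≤
      2 ^ (2 * 2 ^ (k + 1)) * signMean (fun ε => ‖signSum a ε‖ ^ 2 ^ (k + 1)) ^ 2 := by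
  have h := hypercontractive_signSum k 0 a
  simp only [zero_add, norm_smul, mul_pow, signMean_const_mul] at h
  have e : ‖(1 / 2 : ℂ)‖ ^ (2 * 2 ^ (k + 1)) = (2 ^ (2 * 2 ^ (k + 1)) : ℝ)⁻¹ := by
    rw [← inv_pow]; norm_num
  rw [e, inv_mul_le_iff₀ (by positivity)] at h
  exact h

/-! ### The contraction principle -/

/-- Convexity in the multiplier `m` of the moment of a multiplied sum, for a single point. -/
theorem convexOn_norm_multiplied_pow {N : ℕ} (b : Fin N → B) (p : ℕ) :
    ConvexOn ℝ Set.univ (fun m : Fin N → ℂ => ‖∑ n, m n • b n‖ ^ p) := by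
  have h : ConvexOn ℝ Set.univ (fun m : Fin N → ℂ => ‖∑ n, m n • b n‖) := by
    refine ⟨convex_univ, fun x _ y _ s t hs ht _ => ?_⟩
    have e : ∑ n, (s • x + t • y) n • b n = s • ∑ n, x n • b n + t • ∑ n, y n • b n := by
      simp [-Complex.real_smul, add_smul, Finset.sum_add_distrib, Finset.smul_sum, smul_assoc]
    dsimp only
    rw [e]
    refine (norm_add_le _ _).trans (le_of_eq ?_)
    rw [norm_smul, norm_smul, Real.norm_of_nonneg hs, Real.norm_of_nonneg ht]
    rfl
  exact h.pow (fun _ _ => norm_nonneg _) p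

theorem convexOn_signMean_multiplied {N : ℕ} (a : Fin N → B) (p : ℕ) :
    ConvexOn ℝ Set.univ
      (fun m : Fin N → ℂ => signMean fun ε => ‖signSum (fun n => m n • a n) ε‖ ^ p) := by
  refine ⟨convex_univ, fun x _ y _ s t hs ht hst => ?_⟩
  simp only [smul_eq_mul, ← signMean_const_mul, ← signMean_add]
  refine signMean_mono fun ε => ?_
  have h := (convexOn_norm_multiplied_pow (fun n => ((ε n : ℤ) : ℂ) • a n) p).2
    (Set.mem_univ x) (Set.mem_univ y) hs ht hst
  simpa only [signSum, smul_comm (M := ℂ) (N := ℂ), smul_eq_mul] using h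

/-- The contraction principle for real multipliers: a point of the cube `[-1, 1] ^ N` is a convex
combination of sign vectors, and these do not change the moment. -/
theorem signMean_contraction_real {N : ℕ} (a : Fin N → B) (p : ℕ) (t : Fin N → ℝ)
    (ht : ∀ n, |t n| ≤ 1) :
    signMean (fun ε => ‖signSum (fun n => (t n : ℂ) • a n) ε‖ ^ p) ≤
      signMean (fun ε => ‖signSum a ε‖ ^ p) := by
  set V : Set (Fin N → ℂ) := Set.univ.pi fun _ => {1, -1} with hV
  have hmem : (fun n => (t n : ℂ)) ∈ convexHull ℝ V := by
    rw [hV, convexHull_pi]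
    intro n _
    rw [convexHull_pair, segment_eq_image]
    have := abs_le.1 (ht n)
    refine ⟨(1 - t n) / 2, ⟨by linarith, by linarith⟩, ?_⟩
    simp only [Complex.real_smul]
    push_cast
    ring
  refine convexHull_min (s := V) ?_ ((convexOn_signMean_multiplied a p).convex_le
    (signMean (fun ε => ‖signSum a ε‖ ^ p))) hmem |>.2
  intro v hv
  refine ⟨Set.mem_univ _, le_of_eq ?_⟩
  -- A sign vector only permutes the choices of signs.
  have hs : ∀ n, ∃ σ : ℤˣ, v n = ((σ : ℤ) : ℂ) := fun n => by
    rcases hv n (Set.mem_univ n) with h | h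
    · exact ⟨1, by simpa using h⟩
    · exact ⟨-1, by simpa using h⟩
  choose σ hσ using hs
  rw [← signMean_mul_left σ fun ε => ‖signSum a ε‖ ^ p]
  congr 1
  ext ε
  simp only [signSum, hσ, smul_smul, Pi.mul_apply, Units.val_mul, Int.cast_mul,
    mul_comm (((σ _ : ℤˣ) : ℤ) : ℂ)]

/-- The contraction principle for complex multipliers, from that for the real and imaginary
parts. -/
theorem signMean_contraction {N : ℕ} (a : Fin N → B) (p : ℕ) (m : Fin N → ℂ)
    (hm : ∀ n, ‖m n‖ ≤ 1) :
    signMean (fun ε => ‖signSum (fun n => m n • a n) ε‖ ^ (p + 1)) ≤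
      2 ^ (p + 1) * signMean (fun ε => ‖signSum a ε‖ ^ (p + 1)) := by
  have hre := signMean_contraction_real a (p + 1) (fun n => (m n).re)
    fun n => (Complex.abs_re_le_norm _).trans (hm n)
  have him := signMean_contraction_real a (p + 1) (fun n => (m n).im)
    fun n => (Complex.abs_im_le_norm _).trans (hm n)
  have hpt : ∀ ε, ‖signSum (fun n => m n • a n) ε‖ ^ (p + 1) ≤
      2 ^ p * (‖signSum (fun n => ((m n).re : ℂ) • a n) ε‖ ^ (p + 1) +
        ‖signSum (fun n => ((m n).im : ℂ) • a n) ε‖ ^ (p + 1)) := by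
    intro ε
    have e : signSum (fun n => m n • a n) ε = signSum (fun n => ((m n).re : ℂ) • a n) ε +
        Complex.I • signSum (fun n => ((m n).im : ℂ) • a n) ε := by
      simp only [signSum, Finset.smul_sum, ← Finset.sum_add_distrib, smul_smul, ← add_smul]
      refine Finset.sum_congr rfl fun n _ => ?_
      congr 1
      linear_combination -((ε n : ℤ) : ℂ) * Complex.re_add_im (m n)
    rw [e]
    refine (pow_le_pow_left₀ (norm_nonneg _) (norm_add_le _ _) _).trans ?_
    rw [norm_smul, Complex.norm_I, one_mul]
    exact add_pow_le (norm_nonneg _) (norm_nonneg _) (p + 1)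
  have h := signMean_mono hpt
  rw [signMean_const_mul, signMean_add] at h
  refine h.trans ?_
  rw [pow_succ, mul_assoc]
  gcongr
  linarith

/-- Unimodular multipliers change the moments of a Rademacher sum by a bounded factor. -/
theorem signMean_le_of_unimodular {N : ℕ} (a : Fin N → B) (p : ℕ) (m : Fin N → ℂ)
    (hm : ∀ n, ‖m n‖ = 1) :
    signMean (fun ε => ‖signSum a ε‖ ^ (p + 1)) ≤
      2 ^ (p + 1) * signMean (fun ε => ‖signSum (fun n => m n • a n) ε‖ ^ (p + 1)) := by
  have h := signMean_contraction (fun n => m n • a n) p (fun n => (m n)⁻¹) fun n => by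
    simp [hm n]
  have e : (fun n => (m n)⁻¹ • m n • a n) = a := by
    ext n
    rw [inv_smul_smul₀]
    intro h0
    simpa [h0] using hm n
  simpa only [e] using h

end Normed

/-! ### From moments to distributions -/

/-- Markov's inequality for the `p`-th moment. -/
theorem measureReal_ge_le_of_moment {Ω : Type*} [MeasurableSpace Ω] {P : Measure Ω}
    [IsProbabilityMeasure P] {X : Ω → ℝ} (hX0 : ∀ ω, 0 ≤ X ω)
    (hXi : ∀ p : ℕ, Integrable (fun ω => X ω ^ p) P) {s b : ℝ} (hs : 0 < s) (p : ℕ)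
    (h : ∫ ω, X ω ^ p ∂P ≤ b ^ p) : P.real {ω | s ≤ X ω} ≤ (b / s) ^ p := by
  have h1 := mul_meas_ge_le_integral_of_nonneg (μ := P) (f := fun ω => X ω ^ p)
    (Filter.Eventually.of_forall fun ω => pow_nonneg (hX0 ω) p) (hXi p) (s ^ p)
  have h2 : P.real {ω | s ≤ X ω} ≤ P.real {ω | s ^ p ≤ X ω ^ p} :=
    measureReal_mono fun ω (hω : s ≤ X ω) => pow_le_pow_left₀ hs.le hω p
  rw [div_pow, le_div_iff₀ (by positivity), mul_comm]
  exact (mul_le_mul_of_nonneg_left h2 (by positivity)).trans (h1.trans h)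

/-- The Paley–Zygmund inequality for a variable whose exponent can be doubled. -/
theorem le_measureReal_ge_of_doubling {Ω : Type*} [MeasurableSpace Ω] {P : Measure Ω}
    [IsProbabilityMeasure P] {X : Ω → ℝ} (hX : Measurable X) (hX0 : ∀ ω, 0 ≤ X ω)
    (hXi : ∀ p : ℕ, Integrable (fun ω => X ω ^ p) P) {s K : ℝ} (hs : 0 < s) (hK : 0 < K)
    {p : ℕ} (hp : 1 ≤ p) (hm : (2 * s) ^ p ≤ ∫ ω, X ω ^ p ∂P)
    (hd : ∫ ω, X ω ^ (2 * p) ∂P ≤ K ^ (2 * p) * (∫ ω, X ω ^ p ∂P) ^ 2) :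
    ((2 * K) ^ (2 * p))⁻¹ ≤ P.real {ω | s ≤ X ω} := by
  set m := ∫ ω, X ω ^ p ∂P with hm_def
  have hm0 : 0 < m := lt_of_lt_of_le (by positivity) hm
  set A := {ω | s ≤ X ω} with hA
  have hAm : MeasurableSet A := measurableSet_le measurable_const hX
  set q := P.real A with hq
  -- The part of the `p`-th moment below the level `s` is at most half of it.
  have h1 : m ≤ s ^ p + ∫ ω in A, X ω ^ p ∂P := by
    rw [hm_def, ← integral_add_compl hAm (hXi p), add_comm]
    gcongr
    have : ∫ ω in Aᶜ, X ω ^ p ∂P ≤ ∫ ω in Aᶜ, s ^ p ∂P := by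
      refine setIntegral_mono_on (hXi p).integrableOn (integrable_const _).integrableOn hAm.compl
        fun ω hω => pow_le_pow_left₀ (hX0 ω) (le_of_lt (not_le.1 hω)) p
    refine this.trans ?_
    rw [setIntegral_const, smul_eq_mul]
    exact mul_le_of_le_one_left (by positivity) measureReal_le_one
  have h2 : s ^ p ≤ m / 2 := by
    rw [mul_pow] at hm
    have : (2 : ℝ) ≤ 2 ^ p := by simpa using pow_le_pow_right₀ (one_le_two (α := ℝ)) hp
    have : 2 * s ^ p ≤ 2 ^ p * s ^ p := by gcongr
    linarith
  -- For every `r`, `2 r X^p ≤ X^(2p) + r²`; integrating over `A` gives Cauchy–Schwarz.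
  have h3 : ∀ r : ℝ, 2 * r * ∫ ω in A, X ω ^ p ∂P ≤
      (∫ ω, X ω ^ (2 * p) ∂P) + r ^ 2 * q := by
    intro r
    rw [← integral_const_mul]
    calc ∫ ω in A, 2 * r * X ω ^ p ∂P ≤ ∫ ω in A, (X ω ^ (2 * p) + r ^ 2) ∂P := by
          refine integral_mono ((hXi p).integrableOn.const_mul _)
            ((hXi _).integrableOn.add (integrable_const _)) fun ω => ?_
          have : X ω ^ (2 * p) = (X ω ^ p) ^ 2 := by rw [← pow_mul, mul_comm]
          simp only [this]
          nlinarith [sq_nonneg (X ω ^ p - r)]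
      _ = (∫ ω in A, X ω ^ (2 * p) ∂P) + r ^ 2 * q := by
          rw [integral_add (hXi _).integrableOn (integrable_const _), setIntegral_const,
            smul_eq_mul, mul_comm (r ^ 2)]
      _ ≤ _ := by
          refine add_le_add_left (setIntegral_le_integral (hXi _) ?_) _
          exact Filter.Eventually.of_forall fun ω => pow_nonneg (hX0 ω) _
  have hq0 : 0 ≤ q := measureReal_nonneg
  -- The choice `r = 2 K^(2p) m` gives the claim.
  have h4 := h3 (2 * K ^ (2 * p) * m)
  set W := K ^ (2 * p) with hW
  have hW0 : 0 < W := by positivity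
  have h5 : W * m ^ 2 ≤ 4 * W ^ 2 * m ^ 2 * q := by
    have h6 : m / 2 ≤ ∫ ω in A, X ω ^ p ∂P := by linarith
    have : 2 * (2 * W * m) * (m / 2) ≤ 2 * (2 * W * m) * ∫ ω in A, X ω ^ p ∂P := by gcongr
    nlinarith
  have h7 : 1 ≤ 4 * W * q := by
    have : 0 < W * m ^ 2 := by positivity
    by_contra! hlt
    nlinarith
  have h8 : (4 : ℝ) ≤ 2 ^ (2 * p) := by
    have := pow_le_pow_right₀ (one_le_two (α := ℝ)) (show 2 ≤ 2 * p by omega)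
    norm_num at this ⊢
    exact this
  rw [mul_pow, ← hW, inv_le_iff_one_le_mul₀ (by positivity)]
  calc 1 ≤ 4 * W * q := h7
    _ ≤ q * (2 ^ (2 * p) * W) := by
      rw [mul_comm q]
      gcongr

/-- A variable `Y` whose moments of order `2, 4, 8, …` can be doubled dominates in distribution
every variable `X` whose moments are dominated by those of `Y`. The level `α` is compared with the
first moment of `Y` that exceeds it: there Paley–Zygmund bounds the tail of `Y` from below, and
Markov's inequality for the preceding moment bounds the tail of `X` from above. -/
theorem measureReal_ge_le_of_moments {Ω Ω' : Type*} [MeasurableSpace Ω] [MeasurableSpace Ω']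
    {P : Measure Ω} {Q : Measure Ω'} [IsProbabilityMeasure P] [IsProbabilityMeasure Q]
    {X : Ω → ℝ} {Y : Ω' → ℝ} (hY : Measurable Y)
    (hX0 : ∀ ω, 0 ≤ X ω) (hY0 : ∀ ω, 0 ≤ Y ω)
    (hXi : ∀ p : ℕ, Integrable (fun ω => X ω ^ p) P)
    (hYi : ∀ p : ℕ, Integrable (fun ω => Y ω ^ p) Q)
    {A K : ℝ} (hA : 1 ≤ A) (hK : 1 ≤ K)
    (hXY : ∀ k : ℕ, ∫ ω, X ω ^ 2 ^ (k + 1) ∂P ≤ A ^ 2 ^ (k + 1) * ∫ ω, Y ω ^ 2 ^ (k + 1) ∂Q)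
    (hd : ∀ k : ℕ, ∫ ω, Y ω ^ (2 * 2 ^ (k + 1)) ∂Q ≤
      K ^ (2 * 2 ^ (k + 1)) * (∫ ω, Y ω ^ 2 ^ (k + 1) ∂Q) ^ 2)
    {c : ℝ} (hc : 4 * A * (2 * K) ^ 4 ≤ c) {α : ℝ} (hα : 0 < α) :
    P.real {ω | c * α ≤ X ω} ≤ c * Q.real {ω | α ≤ Y ω} := by
  have hK4 : (1 : ℝ) ≤ (2 * K) ^ 4 := one_le_pow₀ (by linarith)
  have hc4 : 4 * A ≤ c := by nlinarith
  have hcK : (2 * K) ^ 4 ≤ c := by nlinarith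
  have hc1 : 1 ≤ c := by linarith
  have hc0 : 0 < c := by linarith
  have hq0 : 0 ≤ Q.real {ω | α ≤ Y ω} := measureReal_nonneg
  have hXm : ∀ k : ℕ, ∫ ω, Y ω ^ 2 ^ (k + 1) ∂Q < (2 * α) ^ 2 ^ (k + 1) →
      P.real {ω | c * α ≤ X ω} ≤ (2 * A / c) ^ 2 ^ (k + 1) := by
    intro k hk
    have h := measureReal_ge_le_of_moment hX0 hXi (s := c * α) (b := A * (2 * α))
      (by positivity) (2 ^ (k + 1)) (by
        rw [mul_pow]
        exact (hXY k).trans (by gcongr))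
    rwa [show A * (2 * α) / (c * α) = 2 * A / c by field_simp] at h
  by_cases hex : ∃ k : ℕ, (2 * α) ^ 2 ^ (k + 1) ≤ ∫ ω, Y ω ^ 2 ^ (k + 1) ∂Q
  · classical
    have hlow := le_measureReal_ge_of_doubling hY hY0 hYi hα (by linarith : 0 < K)
      Nat.one_le_two_pow (Nat.find_spec hex) (hd _)
    rcases hk : Nat.find hex with _ | k
    · rw [hk] at hlow
      norm_num at hlow
      have h1 : P.real {ω | c * α ≤ X ω} ≤ 1 := measureReal_le_one
      have h2 : 1 ≤ c * ((2 * K) ^ 4)⁻¹ := by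
        rw [← div_eq_mul_inv, one_le_div (by positivity)]
        exact hcK
      rw [mul_pow, mul_inv] at h2
      norm_num at h2
      calc P.real {ω | c * α ≤ X ω} ≤ 1 := h1
        _ ≤ _ := by
          refine h2.trans ?_
          gcongr
          rw [mul_pow, mul_inv] at hlow
          norm_num at hlow
          linarith
    · have hprev := hXm k (not_le.1 (Nat.find_min hex (m := k) (by omega)))
      rw [hk] at hlow
      refine hprev.trans (le_trans ?_ (hlow.trans (le_mul_of_one_le_left hq0 hc1)))
      have e : 2 * 2 ^ (k + 1 + 1) = 4 * 2 ^ (k + 1) := by ring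
      rw [e, pow_mul (2 * K) 4, ← inv_pow]
      refine pow_le_pow_left₀ (by positivity) ?_ _
      rw [div_le_iff₀ hc0, ← div_eq_inv_mul, le_div_iff₀ (by positivity)]
      nlinarith
  · -- All moments of `Y` are small, so that `X` is essentially bounded by `2 A α`.
    push Not at hex
    have hz : P.real {ω | c * α ≤ X ω} ≤ 0 := by
      have hlim : Filter.Tendsto (fun k : ℕ => (1 / 2 : ℝ) ^ k) Filter.atTop (nhds 0) :=
        tendsto_pow_atTop_nhds_zero_of_lt_one (by norm_num) (by norm_num)
      refine ge_of_tendsto' hlim fun k => (hXm k (hex k)).trans ?_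
      have h1 : 2 * A / c ≤ 1 / 2 := by
        rw [div_le_iff₀ hc0]
        linarith
      refine (pow_le_pow_left₀ (by positivity) h1 _).trans ?_
      refine pow_le_pow_of_le_one (by norm_num) (by norm_num) ?_
      have := Nat.lt_two_pow_self (n := k + 1)
      omega
    exact hz.trans (by positivity)

/-! ### Rademacher functions and signs -/

theorem measurable_rademacher (n : ℕ) : Measurable (rademacher n) :=
  (measurable_from_top (f := fun k : ℤ => (-1 : ℝ) ^ k)).comp
    (Int.measurable_floor.comp (measurable_const.mul measurable_id))

theorem abs_rademacher (n : ℕ) (t : ℝ) : |rademacher n t| = 1 := by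
  simp [rademacher, abs_zpow]

theorem rademacher_succ (n : ℕ) (t : ℝ) : rademacher (n + 1) t = rademacher n (2 * t) := by
  simp only [rademacher]
  congr 2
  ring

/-- The Rademacher functions of positive index have period `1`. -/
theorem rademacher_sub_one (n : ℕ) (t : ℝ) :
    rademacher (n + 1) (t - 1) = rademacher (n + 1) t := by
  have h : (2 : ℝ) ^ (n + 1) * (t - 1) = 2 ^ (n + 1) * t - ((2 ^ (n + 1) : ℤ) : ℝ) := by
    push_cast
    ring
  have he : Even ((2 : ℤ) ^ (n + 1)) := by simp [pow_succ]
  rw [rademacher, rademacher, h, Int.floor_sub_intCast, zpow_sub₀ (by norm_num), he.neg_one_zpow,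
    div_one]

theorem rademacher_one_left {t : ℝ} (ht : t ∈ Set.Ioo (0 : ℝ) (1 / 2)) : rademacher 1 t = 1 := by
  have h : ⌊(2 : ℝ) ^ 1 * t⌋ = 0 := by
    rw [Int.floor_eq_iff]
    constructor <;> push_cast <;> linarith [ht.1, ht.2]
  rw [rademacher, h]
  norm_num

theorem rademacher_one_right {t : ℝ} (ht : t ∈ Set.Ioo (1 / 2 : ℝ) 1) : rademacher 1 t = -1 := by
  have h : ⌊(2 : ℝ) ^ 1 * t⌋ = 1 := by
    rw [Int.floor_eq_iff]
    constructor <;> push_cast <;> linarith [ht.1, ht.2]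
  rw [rademacher, h]
  norm_num

theorem exists_bound_comp_rademacher {N : ℕ} {φ : (Fin N → ℝ) → ℝ} (hφ : Continuous φ) :
    ∃ M, ∀ t : ℝ, ‖φ fun n => rademacher ((n : ℕ) + 1) t‖ ≤ M := by
  obtain ⟨M, hM⟩ := (isCompact_Icc (a := fun _ : Fin N => (-1 : ℝ))
    (b := fun _ => 1)).exists_bound_of_continuousOn hφ.continuousOn
  refine ⟨M, fun t => hM _ ⟨fun n => ?_, fun n => ?_⟩⟩
  · exact (abs_le.1 (abs_rademacher _ t).le).1
  · exact (abs_le.1 (abs_rademacher _ t).le).2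

theorem measurable_comp_rademacher {N : ℕ} {φ : (Fin N → ℝ) → ℝ} (hφ : Continuous φ) :
    Measurable fun t : ℝ => φ fun n => rademacher ((n : ℕ) + 1) t :=
  hφ.measurable.comp (measurable_pi_lambda _ fun _ => measurable_rademacher _)

theorem intervalIntegrable_comp_rademacher {N : ℕ} {φ : (Fin N → ℝ) → ℝ} (hφ : Continuous φ)
    (u v : ℝ) :
    IntervalIntegrable (fun t : ℝ => φ fun n => rademacher ((n : ℕ) + 1) t) volume u v := by
  obtain ⟨M, hM⟩ := exists_bound_comp_rademacher hφ
  exact (intervalIntegrable_const (c := M)).mono_fun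
    (measurable_comp_rademacher hφ).aestronglyMeasurable
    (Filter.Eventually.of_forall fun t => (hM t).trans (le_abs_self M))

/-- Under Lebesgue measure on `[0, 1]` the first `N` Rademacher functions are independent uniform
signs. The induction splits `[0, 1]` into halves, on which the first function is constant and the
others are the Rademacher functions run at double speed. -/
theorem intervalIntegral_comp_rademacher {N : ℕ} {φ : (Fin N → ℝ) → ℝ} (hφ : Continuous φ) :
    ∫ t in (0 : ℝ)..1, φ (fun n => rademacher ((n : ℕ) + 1) t) =
      signMean fun ε => φ fun n => ((ε n : ℤ) : ℝ) := by
  induction N with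
  | zero =>
    have h : ∀ x : Fin 0 → ℝ, φ x = φ default := fun x => congrArg φ (Subsingleton.elim _ _)
    simp only [signMean_zero, h, intervalIntegral.integral_const]
    simp
  | succ N ih =>
    have hφc : ∀ s : ℝ, Continuous fun x : Fin N → ℝ => φ (Fin.cons s x) := fun s =>
      hφ.comp (Continuous.finCons continuous_const continuous_id)
    have hcons : ∀ t : ℝ, (fun n : Fin (N + 1) => rademacher ((n : ℕ) + 1) t) =
        Fin.cons (rademacher 1 t) fun n : Fin N => rademacher ((n : ℕ) + 1) (2 * t) := by
      intro t
      ext n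
      refine Fin.cases ?_ (fun n => ?_) n
      · simp
      · simp [rademacher_succ ((n : ℕ) + 1)]
    obtain ⟨H, hH⟩ : ∃ H : ℝ → ℝ → ℝ, ∀ s u,
        H s u = φ (Fin.cons s fun n : Fin N => rademacher ((n : ℕ) + 1) u) := ⟨_, fun _ _ => rfl⟩
    have h1 : ∫ t in (0 : ℝ)..(1 / 2), φ (fun n => rademacher ((n : ℕ) + 1) t) =
        ∫ t in (0 : ℝ)..(1 / 2), H 1 (2 * t) := by
      refine intervalIntegral.integral_congr_Ioo_of_le (by norm_num) fun t ht => ?_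
      simp only [hcons, rademacher_one_left ht, hH]
    have h2 : ∫ t in (1 / 2 : ℝ)..1, φ (fun n => rademacher ((n : ℕ) + 1) t) =
        ∫ t in (1 / 2 : ℝ)..1, H (-1) (2 * t - 1) := by
      refine intervalIntegral.integral_congr_Ioo_of_le (by norm_num) fun t ht => ?_
      simp only [hcons, rademacher_one_right ht, hH, rademacher_sub_one]
    rw [← intervalIntegral.integral_add_adjacent_intervals
      (intervalIntegrable_comp_rademacher hφ 0 (1 / 2))
      (intervalIntegrable_comp_rademacher hφ (1 / 2) 1), h1, h2,
      intervalIntegral.integral_comp_mul_left (H 1) (by norm_num),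
      intervalIntegral.integral_comp_mul_sub (H (-1)) (by norm_num) 1]
    norm_num
    simp only [hH]
    have e1 := ih (hφc 1)
    have e2 := ih (hφc (-1))
    have hc : ∀ (σ : ℤˣ) (ε : Fin N → ℤˣ),
        (fun n : Fin (N + 1) => (((Fin.cons σ ε : Fin (N + 1) → ℤˣ) n : ℤ) : ℝ)) =
        Fin.cons ((σ : ℤ) : ℝ) fun n => ((ε n : ℤ) : ℝ) := by
      intro σ ε
      ext n
      refine Fin.cases ?_ (fun n => ?_) n <;> simp
    rw [e1, e2, signMean_succ]
    simp only [hc]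
    norm_num
    ring

instance : IsProbabilityMeasure unitLebesgue := ⟨by simp [unitLebesgue]⟩

theorem integral_unitLebesgue (f : ℝ → ℝ) :
    ∫ t, f t ∂unitLebesgue = ∫ t in (0 : ℝ)..1, f t := by
  rw [unitLebesgue, integral_Icc_eq_integral_Ioc, intervalIntegral.integral_of_le zero_le_one]

/-! ### Sidon sets and multipliers -/

section Character

variable {G : Type*} [CommGroup G] [TopologicalSpace G]
    {B : Type*} [NormedAddCommGroup B] [NormedSpace ℂ B]

theorem continuous_character (χ : PontryaginDual G) : Continuous fun x => ((χ x : Circle) : ℂ) :=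
  continuous_subtype_val.comp (map_continuous χ)

/-- The trigonometric polynomial `∑ cₙ γₙ`, as a continuous function. -/
noncomputable def trigPoly {N : ℕ} (c : Fin N → ℂ) (γ : Fin N → PontryaginDual G) : C(G, ℂ) :=
  ⟨fun x => ∑ n, c n * ((γ n x : Circle) : ℂ),
    continuous_finsetSum _ fun n _ => continuous_const.mul (continuous_character (γ n))⟩

/-- The sum `∑ γₙ(x) aₙ` with coefficients in a Banach space. -/
noncomputable def charSum {N : ℕ} (γ : Fin N → PontryaginDual G) (a : Fin N → B) (x : G) : B :=
  ∑ n, ((γ n x : Circle) : ℂ) • a n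

theorem continuous_charSum {N : ℕ} (γ : Fin N → PontryaginDual G) (a : Fin N → B) :
    Continuous (charSum γ a) :=
  continuous_finsetSum _ fun n _ => (continuous_character (γ n)).smul continuous_const

theorem signSum_character_eq {N : ℕ} (γ : Fin N → PontryaginDual G) (a : Fin N → B)
    (ε : Fin N → ℤˣ) (x : G) : signSum (fun n => ((γ n x : Circle) : ℂ) • a n) ε =
      charSum γ (fun n => ((ε n : ℤ) : ℂ) • a n) x := by
  simp only [signSum, charSum, smul_comm (M := ℂ) (N := ℂ)]

theorem norm_sign (σ : ℤˣ) : ‖((σ : ℤ) : ℂ)‖ = 1 := by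
  rcases Int.units_eq_one_or σ with rfl | rfl <;> simp

end Character

section Group

variable {G : Type*} [CommGroup G] [TopologicalSpace G] [IsTopologicalGroup G]
    [CompactSpace G] [MeasurableSpace G] [BorelSpace G]

instance : IsProbabilityMeasure (haarProb G) := ⟨by
  simpa [haarProb] using Measure.haarMeasure_self (K₀ := (⊤ : TopologicalSpace.PositiveCompacts G))⟩

instance : (haarProb G).IsMulLeftInvariant := by
  unfold haarProb
  infer_instance

theorem integrable_haarProb {F : Type*} [NormedAddCommGroup F] {f : G → F} (hf : Continuous f) :
    Integrable f (haarProb G) :=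
  hf.integrable_of_hasCompactSupport (HasCompactSupport.of_compactSpace f)

theorem integral_character_eq_zero {χ : PontryaginDual G} (hχ : χ ≠ 1) :
    ∫ x, ((χ x : Circle) : ℂ) ∂(haarProb G) = 0 := by
  obtain ⟨g, hg⟩ : ∃ g, χ g ≠ 1 := by
    by_contra! h
    exact hχ (DFunLike.ext _ _ h)
  have h := integral_mul_left_eq_self (μ := haarProb G) (fun x => ((χ x : Circle) : ℂ)) g
  simp only [map_mul, Circle.coe_mul, integral_const_mul] at h
  have h1 : ((χ g : Circle) : ℂ) - 1 ≠ 0 := by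
    rw [sub_ne_zero]
    exact fun e => hg (Circle.ext (by simpa using e))
  have h2 : (((χ g : Circle) : ℂ) - 1) * ∫ x, ((χ x : Circle) : ℂ) ∂(haarProb G) = 0 := by
    rw [sub_mul, h, one_mul, sub_self]
  exact (mul_eq_zero.1 h2).resolve_left h1

open Classical in
theorem fourierHat_trigPoly {N : ℕ} (c : Fin N → ℂ) (γ : Fin N → PontryaginDual G)
    (χ : PontryaginDual G) :
    fourierHat (trigPoly c γ) χ = ∑ n, if γ n = χ then c n else 0 := by
  have e : ∀ x, trigPoly c γ x * (starRingEnd ℂ) ((χ x : Circle) : ℂ) =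
      ∑ n, c n * (((γ n / χ) x : Circle) : ℂ) := by
    intro x
    have hx : ∀ n, (γ n / χ) x = γ n x * (χ x)⁻¹ := fun n => div_eq_mul_inv (γ n x) (χ x)
    simp only [trigPoly, ContinuousMap.coe_mk, Finset.sum_mul, hx, Circle.coe_mul,
      Circle.coe_inv_eq_conj, mul_assoc]
  simp only [fourierHat, e]
  rw [integral_finsetSum _ fun n _ =>
    (integrable_haarProb (continuous_character (γ n / χ))).const_mul (c n)]
  refine Finset.sum_congr rfl fun n _ => ?_
  rw [integral_const_mul]
  split_ifs with h
  · have h1 : ∀ x, ((γ n / χ) x : Circle) = 1 := fun x => by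
      rw [h, div_self']
      rfl
    simp [h1]
  · rw [integral_character_eq_zero (fun h' => h (div_eq_one.1 h')), mul_zero]

/-- The Sidon inequality for trigonometric polynomials, in terms of their coefficients. -/
theorem IsSidonBound.sum_norm_le {E : Set (PontryaginDual G)} {C : ℝ} (hE : IsSidonBound E C)
    {N : ℕ} {γ : Fin N → PontryaginDual G} (hγ : Function.Injective γ) (hγE : ∀ n, γ n ∈ E)
    (c : Fin N → ℂ) : ∑ n, ‖c n‖ ≤ C * ‖trigPoly c γ‖ := by
  classical
  have hspec : IsSpectral E (trigPoly c γ) := by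
    intro χ hχ
    rw [fourierHat_trigPoly]
    refine Finset.sum_eq_zero fun n _ => if_neg ?_
    rintro rfl
    exact hχ (hγE n)
  have hcoef : ∀ n, fourierHat (trigPoly c γ) (γ n) = c n := fun n => by
    simp [fourierHat_trigPoly, hγ.eq_iff]
  have h := hE.2 _ hspec
  rw [← ENNReal.ofReal_le_ofReal_iff (mul_nonneg hE.1.le (norm_nonneg _)),
    ENNReal.ofReal_sum_of_nonneg fun n _ => norm_nonneg _]
  refine le_trans ?_ h
  have h2 := ENNReal.sum_le_tsum (f := fun χ => ENNReal.ofReal ‖fourierHat (trigPoly c γ) χ‖)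
    (Finset.univ.map ⟨γ, hγ⟩)
  simpa [hcoef] using h2

/-- The dual form of the Sidon property: a multiplier bounded by `1` on finitely many characters of
`E` is, up to the factor `C`, a limit of convex combinations of rotated evaluations. Otherwise
a separating functional would be a trigonometric polynomial violating the Sidon inequality. -/
theorem IsSidonBound.smul_mem_closure_convexHull {E : Set (PontryaginDual G)} {C : ℝ}
    (hE : IsSidonBound E C) {N : ℕ} {γ : Fin N → PontryaginDual G} (hγ : Function.Injective γ)
    (hγE : ∀ n, γ n ∈ E) {m : Fin N → ℂ} (hm : ∀ n, ‖m n‖ ≤ 1) :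
    (C⁻¹ : ℂ) • m ∈ closure (convexHull ℝ {v : Fin N → ℂ |
      ∃ (z : ℂ) (g : G), ‖z‖ = 1 ∧ v = fun n => z * ((γ n g : Circle) : ℂ)}) := by
  by_contra hnot
  obtain ⟨f, u, hfu, hu⟩ := RCLike.geometric_hahn_banach_closed_point (𝕜 := ℂ)
    (convex_convexHull ℝ _).closure isClosed_closure hnot
  set c : Fin N → ℂ := fun n => f (Pi.single n 1) with hc
  have hf : ∀ v : Fin N → ℂ, f v = ∑ n, v n * c n := by
    intro v
    have hv : v = ∑ n, v n • (Pi.single n 1 : Fin N → ℂ) := by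
      ext j
      simp [Finset.sum_apply, Pi.single_apply]
    conv_lhs => rw [hv]
    simp [hc]
  have hbound : ∀ g : G, ‖trigPoly c γ g‖ < u := by
    intro g
    obtain ⟨z, hz, hzw⟩ := RCLike.exists_norm_eq_mul_self (trigPoly c γ g)
    have h := hfu _ (subset_closure (subset_convexHull ℝ _ ⟨z, g, hz, rfl⟩))
    have e : f (fun n => z * ((γ n g : Circle) : ℂ)) = z * trigPoly c γ g := by
      rw [hf, trigPoly, ContinuousMap.coe_mk, Finset.mul_sum]
      exact Finset.sum_congr rfl fun n _ => by ring
    rw [e, ← hzw] at h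
    simpa using h
  have hu0 : 0 ≤ u := (norm_nonneg _).trans (hbound 1).le
  have hnorm : ‖trigPoly c γ‖ ≤ u :=
    (ContinuousMap.norm_le _ hu0).2 fun g => (hbound g).le
  have hC := hE.1
  have h1 : RCLike.re (f ((C⁻¹ : ℂ) • m)) ≤ C⁻¹ * ∑ n, ‖c n‖ := by
    refine (RCLike.re_le_norm _).trans ?_
    rw [map_smul, norm_smul, norm_inv, Complex.norm_real, Real.norm_of_nonneg hC.le, hf]
    gcongr
    refine norm_sum_le_of_le _ fun n _ => ?_
    rw [norm_mul]
    exact mul_le_of_le_one_left (norm_nonneg _) (hm n)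
  have h2 : C⁻¹ * ∑ n, ‖c n‖ ≤ u := by
    rw [inv_mul_le_iff₀ hC]
    exact (hE.sum_norm_le hγ hγE c).trans (mul_le_mul_of_nonneg_left hnorm hC.le)
  linarith

variable {B : Type*} [NormedAddCommGroup B] [NormedSpace ℂ B]

theorem integrable_norm_charSum_pow {N : ℕ} (γ : Fin N → PontryaginDual G) (a : Fin N → B)
    (p : ℕ) : Integrable (fun x => ‖charSum γ a x‖ ^ p) (haarProb G) :=
  integrable_haarProb ((continuous_charSum γ a).norm.pow p)

theorem convexOn_integral_charSum {N : ℕ} (γ : Fin N → PontryaginDual G) (a : Fin N → B)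
    (p : ℕ) : ConvexOn ℝ Set.univ
      (fun m : Fin N → ℂ => ∫ x, ‖charSum γ (fun n => m n • a n) x‖ ^ p ∂(haarProb G)) := by
  refine ⟨convex_univ, fun v _ w _ s t hs ht hst => ?_⟩
  have hi := fun m : Fin N → ℂ => integrable_norm_charSum_pow γ (fun n => m n • a n) p
  simp only [smul_eq_mul, ← integral_const_mul]
  rw [← integral_add ((hi v).const_mul s) ((hi w).const_mul t)]
  refine integral_mono (hi _) (((hi v).const_mul s).add ((hi w).const_mul t)) fun x => ?_
  have h := (convexOn_norm_multiplied_pow (fun n => ((γ n x : Circle) : ℂ) • a n) p).2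
    (Set.mem_univ v) (Set.mem_univ w) hs ht hst
  simpa only [charSum, smul_comm (M := ℂ) (N := ℂ), smul_eq_mul] using h

/-- A multiplier bounded by `1` on a Sidon set increases the `p`-th moment of a vector-valued sum
of characters by a factor of at most `C ^ p`. -/
theorem IsSidonBound.integral_multiplier_le {E : Set (PontryaginDual G)} {C : ℝ}
    (hE : IsSidonBound E C) {N : ℕ} {γ : Fin N → PontryaginDual G} (hγ : Function.Injective γ)
    (hγE : ∀ n, γ n ∈ E) {m : Fin N → ℂ} (hm : ∀ n, ‖m n‖ ≤ 1) (a : Fin N → B) (p : ℕ) :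
    ∫ x, ‖charSum γ (fun n => m n • a n) x‖ ^ p ∂(haarProb G) ≤
      C ^ p * ∫ x, ‖charSum γ a x‖ ^ p ∂(haarProb G) := by
  have hconv := convexOn_integral_charSum γ a p
  set M := ∫ x, ‖charSum γ a x‖ ^ p ∂(haarProb G) with hM
  set J : (Fin N → ℂ) → ℝ :=
    fun m => ∫ x, ‖charSum γ (fun n => m n • a n) x‖ ^ p ∂(haarProb G) with hJ
  have hcont : Continuous J := by
    rw [← continuousOn_univ]
    exact hconv.continuousOn isOpen_univ
  have hsub : closure (convexHull ℝ {v : Fin N → ℂ |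
      ∃ (z : ℂ) (g : G), ‖z‖ = 1 ∧ v = fun n => z * ((γ n g : Circle) : ℂ)}) ⊆
      {v | J v ≤ M} := by
    refine closure_minimal (convexHull_min ?_ ?_) (isClosed_le hcont continuous_const)
    · rintro v ⟨z, g, hz, rfl⟩
      -- A rotated evaluation acts on the sum as a translation followed by a rotation.
      have e : ∀ x, ‖charSum γ (fun n => (z * ((γ n g : Circle) : ℂ)) • a n) x‖ =
          ‖charSum γ a (g * x)‖ := by
        intro x
        have : charSum γ (fun n => (z * ((γ n g : Circle) : ℂ)) • a n) x =
            z • charSum γ a (g * x) := by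
          simp only [charSum, Finset.smul_sum, smul_smul, map_mul, Circle.coe_mul]
          refine Finset.sum_congr rfl fun n _ => ?_
          congr 1
          ring
        rw [this, norm_smul, hz, one_mul]
      rw [Set.mem_ofPred_eq]
      refine le_of_eq ?_
      simp only [hJ, e]
      exact integral_mul_left_eq_self (μ := haarProb G) (fun x => ‖charSum γ a x‖ ^ p) g
    · simpa using hconv.convex_le M
  have h := hsub (hE.smul_mem_closure_convexHull hγ hγE hm)
  have hC := hE.1
  have e : ∀ x, charSum γ (fun n => m n • a n) x =
      (C : ℂ) • charSum γ (fun n => ((C⁻¹ : ℂ) • m) n • a n) x := by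
    intro x
    simp only [charSum, Finset.smul_sum]
    refine Finset.sum_congr rfl fun n _ => ?_
    rw [smul_comm (C : ℂ), Pi.smul_apply, smul_assoc, smul_inv_smul₀]
    exact_mod_cast hC.ne'
  simp only [e, norm_smul, Complex.norm_real, Real.norm_of_nonneg hC.le, mul_pow,
    integral_const_mul]
  exact mul_le_mul_of_nonneg_left h (by positivity)

/-! ### Comparison of moments -/

theorem integral_signMean {N : ℕ} {f : (Fin N → ℤˣ) → G → ℝ}
    (hf : ∀ ε, Integrable (f ε) (haarProb G)) :
    ∫ x, signMean (fun ε => f ε x) ∂(haarProb G) =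
      signMean fun ε => ∫ x, f ε x ∂(haarProb G) := by
  simp only [signMean, integral_div]
  rw [integral_finsetSum _ fun ε _ => hf ε]

theorem integrable_signMean_charSum {N : ℕ} (γ : Fin N → PontryaginDual G) (a : Fin N → B)
    (p : ℕ) : Integrable (fun x => signMean fun ε =>
      ‖charSum γ (fun n => ((ε n : ℤ) : ℂ) • a n) x‖ ^ p) (haarProb G) :=
  (integrable_finsetSum _ fun _ _ => integrable_norm_charSum_pow γ _ p).div_const _

/-- The moments of a sum of characters from a Sidon set are bounded by those of the Rademacher sum:
the signs `ε` are inserted as a multiplier, averaged over, and the values `γₙ(x)` are then removed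
by contraction. -/
theorem IsSidonBound.integral_charSum_le {E : Set (PontryaginDual G)} {C : ℝ}
    (hE : IsSidonBound E C) {N : ℕ} {γ : Fin N → PontryaginDual G} (hγ : Function.Injective γ)
    (hγE : ∀ n, γ n ∈ E) (a : Fin N → B) (p : ℕ) :
    ∫ x, ‖charSum γ a x‖ ^ (p + 1) ∂(haarProb G) ≤
      (2 * C) ^ (p + 1) * signMean fun ε => ‖signSum a ε‖ ^ (p + 1) := by
  have h1 : ∀ ε : Fin N → ℤˣ, ∫ x, ‖charSum γ a x‖ ^ (p + 1) ∂(haarProb G) ≤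
      C ^ (p + 1) *
        ∫ x, ‖charSum γ (fun n => ((ε n : ℤ) : ℂ) • a n) x‖ ^ (p + 1) ∂(haarProb G) := by
    intro ε
    have h := hE.integral_multiplier_le hγ hγE (fun n => (norm_sign (ε n)).le)
      (fun n => ((ε n : ℤ) : ℂ) • a n) (p + 1)
    have e : ∀ n, ((ε n : ℤ) : ℂ) • ((ε n : ℤ) : ℂ) • a n = a n := fun n => by
      rcases Int.units_eq_one_or (ε n) with h | h <;> simp [h]
    simpa only [e] using h
  have h2 := signMean_mono h1
  rw [signMean_const, signMean_const_mul,
    ← integral_signMean fun ε => integrable_norm_charSum_pow γ _ (p + 1)] at h2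
  refine h2.trans ?_
  rw [mul_comm 2 C, mul_pow, mul_assoc]
  refine mul_le_mul_of_nonneg_left ?_ (pow_nonneg hE.1.le _)
  have h3 := integral_mono (integrable_signMean_charSum γ a (p + 1)) (integrable_const _)
    fun x => by
      have := signMean_contraction a p (fun n => ((γ n x : Circle) : ℂ)) fun n =>
        (Circle.norm_coe _).le
      simpa only [signSum_character_eq] using this
  simpa using h3

/-- The moments of a Rademacher sum are bounded by those of the sum of characters from a Sidon
set, by the same two steps in reverse order. -/
theorem IsSidonBound.signMean_signSum_le {E : Set (PontryaginDual G)} {C : ℝ}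
    (hE : IsSidonBound E C) {N : ℕ} {γ : Fin N → PontryaginDual G} (hγ : Function.Injective γ)
    (hγE : ∀ n, γ n ∈ E) (a : Fin N → B) (p : ℕ) :
    (signMean fun ε => ‖signSum a ε‖ ^ (p + 1)) ≤
      (2 * C) ^ (p + 1) * ∫ x, ‖charSum γ a x‖ ^ (p + 1) ∂(haarProb G) := by
  have h3 := integral_mono (μ := haarProb G) (integrable_const _)
    ((integrable_signMean_charSum γ a (p + 1)).const_mul (2 ^ (p + 1))) fun x => by
      have := signMean_le_of_unimodular a p (fun n => ((γ n x : Circle) : ℂ)) fun n =>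
        Circle.norm_coe _
      simpa only [signSum_character_eq] using this
  rw [integral_const_mul, integral_signMean fun ε => integrable_norm_charSum_pow γ _ (p + 1)] at h3
  have h2 := signMean_mono fun ε : Fin N → ℤˣ =>
    hE.integral_multiplier_le hγ hγE (fun n => (norm_sign (ε n)).le) a (p + 1)
  rw [signMean_const] at h2
  simp only [integral_const, probReal_univ, one_smul] at h3
  rw [mul_pow, mul_assoc]
  exact h3.trans (mul_le_mul_of_nonneg_left h2 (by positivity))

end Group

/-! ### Comparison of distributions -/

section Rademacher

variable {B : Type*} [NormedAddCommGroup B] [NormedSpace ℂ B]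

/-- The sum `∑ rₙ₊₁(t) aₙ` of Rademacher functions with coefficients in a Banach space. -/
noncomputable def rademacherSum {N : ℕ} (a : Fin N → B) (t : ℝ) : B :=
  ∑ n : Fin N, (rademacher ((n : ℕ) + 1) t : ℂ) • a n

theorem continuous_norm_real_sum_pow {N : ℕ} (a : Fin N → B) (p : ℕ) :
    Continuous fun x : Fin N → ℝ => ‖∑ n, (x n : ℂ) • a n‖ ^ p := by
  fun_prop

theorem integral_norm_rademacherSum_pow {N : ℕ} (a : Fin N → B) (p : ℕ) :
    ∫ t, ‖rademacherSum a t‖ ^ p ∂unitLebesgue = signMean fun ε => ‖signSum a ε‖ ^ p := by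
  rw [integral_unitLebesgue]
  refine (intervalIntegral_comp_rademacher (continuous_norm_real_sum_pow a p)).trans ?_
  simp [signSum]

theorem integrable_norm_rademacherSum_pow {N : ℕ} (a : Fin N → B) (p : ℕ) :
    Integrable (fun t => ‖rademacherSum a t‖ ^ p) unitLebesgue := by
  obtain ⟨M, hM⟩ := exists_bound_comp_rademacher (continuous_norm_real_sum_pow a p)
  exact Integrable.of_bound
    (measurable_comp_rademacher (continuous_norm_real_sum_pow a p)).aestronglyMeasurable M
    (Filter.Eventually.of_forall hM)

theorem measurable_norm_rademacherSum {N : ℕ} (a : Fin N → B) :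
    Measurable fun t => ‖rademacherSum a t‖ := by
  simpa [rademacherSum] using measurable_comp_rademacher (continuous_norm_real_sum_pow a 1)

end Rademacher

/-- The infimum `sidonConstant E` need not be shown to be attained: a constant slightly above it,
still controlled by it alone, is enough. -/
theorem exists_isSidonBound_le {G : Type*} [CommGroup G] [TopologicalSpace G]
    [IsTopologicalGroup G] [CompactSpace G] [MeasurableSpace G] [BorelSpace G]
    {E : Set (PontryaginDual G)} (hE : IsSidonSet E) :
    ∃ C, IsSidonBound E C ∧ C ≤ |sidonConstant E| + 1 := by
  obtain ⟨C, hC, hlt⟩ := exists_lt_of_csInf_lt (s := {c : ℝ | IsSidonBound E c}) hE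
    (lt_add_one (sidonConstant E))
  exact ⟨C, hC, hlt.le.trans (add_le_add_left (le_abs_self _) 1)⟩

end Sidon

theorem theorem1p3 (S : ℝ) :
    ∃ c : ℝ, 0 < c ∧
      ∀ (G : Type*) [CommGroup G] [TopologicalSpace G] [IsTopologicalGroup G]
        [CompactSpace G] [T2Space G] [MeasurableSpace G] [BorelSpace G]
        (E : Set (PontryaginDual G)), Sidon.IsSidonSet E → Sidon.sidonConstant E = S →
      ∀ (B : Type*) [NormedAddCommGroup B] [NormedSpace ℂ B] [CompleteSpace B]
        (N : ℕ) (γ : Fin N → PontryaginDual G), Function.Injective γ → (∀ n, γ n ∈ E) →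
      ∀ (a : Fin N → B) (α : ℝ), 0 < α →
        c⁻¹ * Sidon.unitLebesgue.real
            {t : ℝ | c * α ≤ ‖∑ n : Fin N, (Sidon.rademacher ((n : ℕ) + 1) t : ℂ) • a n‖}
          ≤ (Sidon.haarProb G).real {x : G | α ≤ ‖∑ n : Fin N, ((γ n x : Circle) : ℂ) • a n‖} ∧
        (Sidon.haarProb G).real {x : G | α ≤ ‖∑ n : Fin N, ((γ n x : Circle) : ℂ) • a n‖}
          ≤ c * Sidon.unitLebesgue.real
            {t : ℝ | c⁻¹ * α ≤ ‖∑ n : Fin N, (Sidon.rademacher ((n : ℕ) + 1) t : ℂ) • a n‖} := by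
  -- `A` compares the `Lᵖ` norms of the two sums, and `K` bounds the cost of doubling `p` in both.
  set A : ℝ := 2 * (|S| + 1) with hA
  have hA1 : 1 ≤ A := by linarith [abs_nonneg S]
  set K : ℝ := 2 * A ^ 2 with hK
  have hA2 : 1 ≤ A ^ 2 := one_le_pow₀ hA1
  have hK2 : 2 ≤ K := by linarith
  have hc : 0 < 4 * A * (2 * K) ^ 4 := by positivity
  refine ⟨4 * A * (2 * K) ^ 4, hc, ?_⟩
  intro G _ _ _ _ _ _ _ E hE hS B _ _ _ N γ hγ hγE a α hα
  set c := 4 * A * (2 * K) ^ 4 with hc_def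
  obtain ⟨C, hC, hCS⟩ := Sidon.exists_isSidonBound_le hE
  have hC0 := hC.1
  have hCA : 2 * C ≤ A := by rw [hA, ← hS]; linarith
  have hpos : ∀ k : ℕ, ∃ p, 2 ^ (k + 1) = p + 1 := fun k =>
    Nat.exists_eq_succ_of_ne_zero (by positivity)
  have hYX : ∀ k : ℕ, ∫ x, ‖Sidon.charSum γ a x‖ ^ 2 ^ (k + 1) ∂(Sidon.haarProb G) ≤
      A ^ 2 ^ (k + 1) * ∫ t, ‖Sidon.rademacherSum a t‖ ^ 2 ^ (k + 1) ∂Sidon.unitLebesgue := by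
    intro k
    obtain ⟨p, hp⟩ := hpos k
    rw [Sidon.integral_norm_rademacherSum_pow, hp]
    refine (hC.integral_charSum_le hγ hγE a p).trans ?_
    refine mul_le_mul_of_nonneg_right (pow_le_pow_left₀ (by positivity) hCA _) ?_
    exact Sidon.signMean_nonneg fun ε => by positivity
  have hXY : ∀ k : ℕ, ∫ t, ‖Sidon.rademacherSum a t‖ ^ 2 ^ (k + 1) ∂Sidon.unitLebesgue ≤
      A ^ 2 ^ (k + 1) * ∫ x, ‖Sidon.charSum γ a x‖ ^ 2 ^ (k + 1) ∂(Sidon.haarProb G) := by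
    intro k
    obtain ⟨p, hp⟩ := hpos k
    rw [Sidon.integral_norm_rademacherSum_pow, hp]
    refine (hC.signMean_signSum_le hγ hγE a p).trans ?_
    refine mul_le_mul_of_nonneg_right (pow_le_pow_left₀ (by positivity) hCA _) ?_
    exact integral_nonneg fun x => by positivity
  have hdX : ∀ k : ℕ, ∫ t, ‖Sidon.rademacherSum a t‖ ^ (2 * 2 ^ (k + 1)) ∂Sidon.unitLebesgue ≤
      2 ^ (2 * 2 ^ (k + 1)) *
        (∫ t, ‖Sidon.rademacherSum a t‖ ^ 2 ^ (k + 1) ∂Sidon.unitLebesgue) ^ 2 := by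
    intro k
    simp only [Sidon.integral_norm_rademacherSum_pow]
    exact Sidon.signMean_norm_signSum_doubling k a
  have hdY : ∀ k : ℕ, ∫ x, ‖Sidon.charSum γ a x‖ ^ (2 * 2 ^ (k + 1)) ∂(Sidon.haarProb G) ≤
      K ^ (2 * 2 ^ (k + 1)) *
        (∫ x, ‖Sidon.charSum γ a x‖ ^ 2 ^ (k + 1) ∂(Sidon.haarProb G)) ^ 2 := by
    intro k
    have h1 := hYX (k + 1)
    rw [show 2 ^ (k + 1 + 1) = 2 * 2 ^ (k + 1) by ring] at h1
    have h0 : 0 ≤ ∫ t, ‖Sidon.rademacherSum a t‖ ^ 2 ^ (k + 1) ∂Sidon.unitLebesgue :=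
      integral_nonneg fun t => by positivity
    refine h1.trans ((mul_le_mul_of_nonneg_left ((hdX k).trans (mul_le_mul_of_nonneg_left
      (pow_le_pow_left₀ h0 (hXY k) 2) (by positivity))) (by positivity)).trans (le_of_eq ?_))
    rw [hK]
    generalize ∫ x, ‖Sidon.charSum γ a x‖ ^ 2 ^ (k + 1) ∂(Sidon.haarProb G) = m
    generalize 2 ^ (k + 1) = q
    simp only [mul_pow, ← pow_mul]
    generalize (2 : ℝ) ^ (2 * q) = w
    ring
  have hX := Sidon.measurable_norm_rademacherSum a
  have hY := (Sidon.continuous_charSum γ a).norm.measurable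
  have hXi := Sidon.integrable_norm_rademacherSum_pow a
  have hYi := Sidon.integrable_norm_charSum_pow γ a
  constructor
  · rw [inv_mul_le_iff₀ hc]
    exact Sidon.measureReal_ge_le_of_moments hY (fun _ => norm_nonneg _)
      (fun _ => norm_nonneg _) hXi hYi hA1 (by linarith) hXY hdY le_rfl hα
  · have h := Sidon.measureReal_ge_le_of_moments hX (fun _ => norm_nonneg _)
      (fun _ => norm_nonneg _) hYi hXi hA1 (by linarith) hYX
      (fun k => (hdX k).trans (by gcongr)) (le_refl c) (α := c⁻¹ * α) (by positivity)
    rwa [mul_inv_cancel_left₀ hc.ne'] at h
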